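/- For complex $q$ with $|q|<1$ put $$\theta_2(q)=\sum_{m\in\mathbb{Z}+\frac12}q^{m^2},\qquad \theta_3(q)=\sum_{m\in\mathbb{Z}}q^{m^2},\qquad \theta_4(q)=\sum_{m\in\mathbb{Z}}(-1)^mq^{m^2},\qquad E_2(q)=1-24\sum_{n\ge1}\sigma_1(n)q^n,$$ where $\sigma_1(n)=\sum_{d\mid n}d$ and, in $\theta_2$, $q^{m^2}$ is taken with the principal branch (only $\theta_2^4$ is used below, and it does not depend on the branch). Put $$\Theta_{r,s}(q)=\theta_2(q)^{4r}\theta_3(q)^{4s}+\theta_2(q)^{4s}\theta_3(q)^{4r}\quad(r,s\ge0),\qquad D=q\frac{d}{dq}.$$ Define rational numbers $c_c(\alpha,\beta,\gamma)$ for integers $\alpha,\beta,\gamma$ by $c_c(\alpha,\beta,\gamma)=0$ if any argument is negative, $c_c(0,0,0)=1$, and, for all other $\alpha,\beta,\gamma\ge0$, $$\begin{aligned} c_c(\alpha,\beta,\gamma)&=\tfrac{2\alpha+4\beta+4\gamma-1}{24}\,c_c(\alpha-1,\beta,\gamma)+\tfrac{20\gamma-4\beta+3}{24}\,c_c(\alpha,\beta-1,\gamma)+\tfrac{20\beta-4\gamma+3}{24}\,c_c(\alpha,\beta,\gamma-1)\\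 &\quad-\tfrac{7(\alpha+1)}{6}\,c_c(\alpha+1,\beta-1,\gamma-1)-\tfrac{\alpha+1}{12}\,c_c(\alpha+1,\beta-2,\gamma)-\tfrac{\alpha+1}{12}\,c_c(\alpha+1,\beta,\gamma-2). \end{aligned}$$ Then for every integer $t\ge1$ and every complex $q$ with $|q|<1$ one has $\theta_4(q)\ne0$ and $$\frac{(D^t\theta_4)(q)}{\theta_4(q)}=\frac12\sum_{\substack{\alpha,\beta,\gamma\ge0\\ \alpha+\beta+\gamma=t}}c_c(\alpha,\beta,\gamma)\,E_2(q)^{\alpha}\,\Theta_{\beta,\gamma}(q).$$ -/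

import Mathlib

noncomputable section

namespace QTheta

/-- The Eisenstein series `E_{2k}(q) = 1 - (4k / B_{2k}) ∑_{n ≥ 1} σ_{2k-1}(n) q^n`. -/
def eisenstein (k : ℕ) (q : ℂ) : ℂ :=
  1 - (4 * (k : ℂ) / ((bernoulli (2 * k) : ℚ) : ℂ)) *
    ∑' n : ℕ+, (ArithmeticFunction.sigma (2 * k - 1) (n : ℕ) : ℂ) * q ^ (n : ℕ)

/-- `θ₂(q) = ∑_{m ∈ ℤ + 1/2} q^{m²}`, with the principal branch of the complex power;
every branch gives the same value of `θ₂(q)^4`. -/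
def theta2 (q : ℂ) : ℂ := ∑' m : ℤ, q ^ (((m : ℂ) + 1 / 2) ^ 2)

/-- `θ₃(q) = ∑_{m ∈ ℤ} q^{m²}`. -/
def theta3 (q : ℂ) : ℂ := ∑' m : ℤ, q ^ (m ^ 2)

/-- `θ₄(q) = ∑_{m ∈ ℤ} (-1)^m q^{m²}`. -/
def theta4 (q : ℂ) : ℂ := ∑' m : ℤ, (-1 : ℂ) ^ m * q ^ (m ^ 2)

/-- `Θ_{r,s}(q) = θ₂^{4r} θ₃^{4s} + θ₂^{4s} θ₃^{4r}`. -/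
def Theta (r s : ℕ) (q : ℂ) : ℂ :=
  theta2 q ^ (4 * r) * theta3 q ^ (4 * s) + theta2 q ^ (4 * s) * theta3 q ^ (4 * r)

/-- The operator `D = q d/dq`. -/
def D (f : ℂ → ℂ) : ℂ → ℂ := fun q => q * deriv f q

/-- The rational coefficients `c_c(α, β, γ)`: zero if an argument is negative, one at the origin,
and given by the six-term recursion otherwise. -/
def cc (α β γ : ℤ) : ℚ :=
  if α < 0 ∨ β < 0 ∨ γ < 0 then 0
  else if α = 0 ∧ β = 0 ∧ γ = 0 then 1
  else
    (2 * α + 4 * β + 4 * γ - 1) / 24 * cc (α - 1) β γ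
    + (20 * γ - 4 * β + 3) / 24 * cc α (β - 1) γ
    + (20 * β - 4 * γ + 3) / 24 * cc α β (γ - 1)
    - 7 * (α + 1) / 6 * cc (α + 1) (β - 1) (γ - 1)
    - (α + 1) / 12 * cc (α + 1) (β - 2) γ
    - (α + 1) / 12 * cc (α + 1) β (γ - 2)
termination_by (α + β + γ).toNat
decreasing_by all_goals omega

end QTheta

end

/-!
The theta series at `q` and at `q²` are related by quadratic transformations. Since `q ^ 2 ^ n → 0`,
a continuous `F` on the unit disc with `F(q) = F(q²)` is constant, and a differentiable `F` with
`F(0) = 0` and `F(q) = c F(q²)` vanishes. This descent gives the non-vanishing of the theta series,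
the differences of their logarithmic derivatives, and the formula for `D E₂`; the logarithmic
derivative of `θ₄` itself comes from Gauss's product `θ₄(q) φ(q²) = φ(q)²`, where
`φ(q) = ∏ (1 - q ^ j)`, a case of the Jacobi triple product. Hence `D` maps
`θ₄ E₂^α θ₂^{4β} θ₃^{4γ}` to a combination of such products with `α + β + γ` one larger, and the
recursion defining `cc` is the transpose of this map. Symmetrizing with `cc α β γ = cc α γ β` turns
the monomials `θ₂^{4β} θ₃^{4γ}` into `Θ_{β,γ} / 2`.
-/

noncomputable section

namespace QTheta

open Filter Topology

/-! ### Theta series as integer-indexed power series -/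

/-- The series `∑_{m ∈ ℤ} q ^ e(m)`, a common form for `θ₃` and `ψ`. The exponents are natural
numbers, so that it is a power series in `q`. -/
def intPowSeries (e : ℤ → ℕ) (q : ℂ) : ℂ := ∑' m : ℤ, q ^ e m

section intPowSeries

variable {e f : ℤ → ℕ} {p q : ℂ}

lemma summable_pow_natAbs {r : ℝ} (h0 : 0 ≤ r) (h1 : r < 1) :
    Summable fun m : ℤ => r ^ m.natAbs := by
  refine Summable.of_nat_of_neg ?_ ?_ <;> simpa using summable_geometric_of_lt_one h0 h1

lemma norm_pow_le_of_natAbs_le {n : ℕ} {m : ℤ} (hn : m.natAbs ≤ n + 1) {r : ℝ} (h0 : 0 < r)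
    (h1 : r < 1) (hq : ‖q‖ ≤ r) : ‖q ^ n‖ ≤ r⁻¹ * r ^ m.natAbs := by
  rw [norm_pow]
  calc ‖q‖ ^ n ≤ r ^ n := pow_le_pow_left₀ (norm_nonneg _) hq _
    _ = r⁻¹ * r ^ (n + 1) := by rw [pow_succ']; field_simp
    _ ≤ r⁻¹ * r ^ m.natAbs := by
      gcongr r⁻¹ * ?_
      exact pow_le_pow_of_le_one h0.le h1.le hn

lemma exists_norm_lt_lt_one (hq : ‖q‖ < 1) : ∃ r : ℝ, 0 < r ∧ r < 1 ∧ ‖q‖ < r := by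
  obtain ⟨r, h1, h2⟩ := exists_between hq
  exact ⟨r, (norm_nonneg q).trans_lt h1, h2, h1⟩

lemma summable_norm_intPow (he : ∀ m, m.natAbs ≤ e m + 1) (hq : ‖q‖ < 1) :
    Summable fun m : ℤ => ‖q ^ e m‖ := by
  obtain ⟨r, h0, h1, h⟩ := exists_norm_lt_lt_one hq
  exact .of_nonneg_of_le (fun _ => norm_nonneg _)
    (fun m => norm_pow_le_of_natAbs_le (he m) h0 h1 h.le)
    ((summable_pow_natAbs h0.le h1).mul_left _)

lemma differentiableAt_intPowSeries (he : ∀ m, m.natAbs ≤ e m + 1) (hq : ‖q‖ < 1) :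
    DifferentiableAt ℂ (intPowSeries e) q := by
  obtain ⟨r, h0, h1, h⟩ := exists_norm_lt_lt_one hq
  have hd : DifferentiableOn ℂ (intPowSeries e) (Metric.ball 0 r) :=
    Complex.differentiableOn_tsum_of_summable_norm ((summable_pow_natAbs h0.le h1).mul_left r⁻¹)
      (fun m => by fun_prop) Metric.isOpen_ball fun m w hw =>
        norm_pow_le_of_natAbs_le (he m) h0 h1 (mem_ball_zero_iff.1 hw).le
  exact hd.differentiableAt (Metric.isOpen_ball.mem_nhds (mem_ball_zero_iff.2 h))

lemma intPowSeries_mul (he : ∀ m, m.natAbs ≤ e m + 1) (hf : ∀ m, m.natAbs ≤ f m + 1)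
    (hp : ‖p‖ < 1) (hq : ‖q‖ < 1) :
    intPowSeries e p * intPowSeries f q = ∑' v : ℤ × ℤ, p ^ e v.1 * q ^ f v.2 :=
  tsum_mul_tsum_of_summable_norm (summable_norm_intPow he hp) (summable_norm_intPow hf hq)

lemma summable_intPow_mul (he : ∀ m, m.natAbs ≤ e m + 1) (hf : ∀ m, m.natAbs ≤ f m + 1)
    (hp : ‖p‖ < 1) (hq : ‖q‖ < 1) : Summable fun v : ℤ × ℤ => p ^ e v.1 * q ^ f v.2 :=
  summable_mul_of_summable_norm (f := fun m => p ^ e m) (g := fun m => q ^ f m)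
    (summable_norm_intPow he hp) (summable_norm_intPow hf hq)

end intPowSeries

/-- The series `∑_{m ∈ ℤ} q ^ (m² + m)`: the factor of `θ₂(q) = q ^ (1/4) ψ(q)` that is
holomorphic in the unit disc. -/
def psi (q : ℂ) : ℂ := intPowSeries (fun m => (m ^ 2 + m).toNat) q

lemma toNat_sq_add_self (m : ℤ) : ((m ^ 2 + m).toNat : ℤ) = m ^ 2 + m :=
  Int.toNat_of_nonneg (by
    rcases le_or_gt 0 m with h | h
    · positivity
    · nlinarith)

lemma natAbs_le_toNat_sq_add_self (m : ℤ) : m.natAbs ≤ (m ^ 2 + m).toNat + 1 := by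
  zify
  rw [toNat_sq_add_self]
  rcases le_or_gt 0 m with h | h
  · rw [abs_of_nonneg h]; nlinarith
  · rw [abs_of_neg h]; nlinarith [sq_nonneg (m + 1)]

lemma natAbs_le_natAbs_sq (m : ℤ) : m.natAbs ≤ m.natAbs ^ 2 + 1 := by nlinarith

lemma zpow_sq_eq_pow_natAbs_sq (q : ℂ) (m : ℤ) : q ^ (m ^ 2) = q ^ (m.natAbs ^ 2) := by
  rw [← zpow_natCast]; simp

lemma theta3_eq_intPowSeries : theta3 = intPowSeries fun m => m.natAbs ^ 2 := by
  ext q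
  simp only [theta3, intPowSeries, zpow_sq_eq_pow_natAbs_sq]

lemma neg_one_zpow_eq_pow_natAbs_sq (m : ℤ) : (-1 : ℂ) ^ m = (-1) ^ (m.natAbs ^ 2) := by
  rcases Int.even_or_odd m with h | h
  · rw [h.neg_one_zpow, Even.neg_one_pow]
    exact (Int.natAbs_even.2 h).pow_of_ne_zero two_ne_zero
  · rw [h.neg_one_zpow, Odd.neg_one_pow]
    exact (Int.natAbs_odd.2 h).pow

lemma theta4_eq_theta3_neg (q : ℂ) : theta4 q = theta3 (-q) := by
  rw [theta3_eq_intPowSeries]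
  simp only [theta4, intPowSeries, zpow_sq_eq_pow_natAbs_sq]
  exact tsum_congr fun m => by rw [neg_pow q, neg_one_zpow_eq_pow_natAbs_sq]

lemma theta2_eq_cpow_mul_psi (q : ℂ) : theta2 q = q ^ (1 / 4 : ℂ) * psi q := by
  rw [theta2, psi, intPowSeries, ← tsum_mul_left]
  refine tsum_congr fun m => ?_
  rcases eq_or_ne q 0 with rfl | hq
  · have hm : (m : ℂ) + 1 / 2 ≠ 0 := fun h => by
      have : (2 * m + 1 : ℂ) = 0 := by linear_combination 2 * h
      have : (2 * m + 1 : ℤ) = 0 := by exact_mod_cast this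
      omega
    rw [Complex.zero_cpow (pow_ne_zero 2 hm), Complex.zero_cpow (by norm_num), zero_mul]
  · rw [← Complex.cpow_natCast q, ← Complex.cpow_add _ _ hq]
    congr 1
    have := congrArg (Int.cast : ℤ → ℂ) (toNat_sq_add_self m)
    push_cast at this
    rw [this]; ring

lemma theta2_pow_four (q : ℂ) : theta2 q ^ 4 = q * psi q ^ 4 := by
  rw [theta2_eq_cpow_mul_psi, mul_pow, ← Complex.cpow_nat_mul]
  norm_num

lemma theta3_zero : theta3 0 = 1 := by
  rw [theta3_eq_intPowSeries, intPowSeries, tsum_eq_single 0 fun m hm => by simp [hm]]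
  simp

lemma theta4_zero : theta4 0 = 1 := by rw [theta4_eq_theta3_neg, neg_zero, theta3_zero]

lemma theta2_zero_pow_four : theta2 0 ^ 4 = 0 := by rw [theta2_pow_four, zero_mul]

lemma psi_zero : psi 0 = 2 := by
  rw [psi, intPowSeries, tsum_eq_sum (s := {0, -1})]
  · norm_num
  · intro m hm
    simp only [Finset.mem_insert, Finset.mem_singleton, not_or] at hm
    refine zero_pow fun h => ?_
    have hm0 : m * (m + 1) = 0 := by
      linear_combination -toNat_sq_add_self m + congrArg (Nat.cast : ℕ → ℤ) h
    rcases mul_eq_zero.1 hm0 with h | h <;> omega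

section differentiable

variable {q : ℂ}

@[fun_prop]
lemma differentiableAt_theta3 (hq : ‖q‖ < 1) : DifferentiableAt ℂ theta3 q := by
  rw [theta3_eq_intPowSeries]
  exact differentiableAt_intPowSeries natAbs_le_natAbs_sq hq

@[fun_prop]
lemma differentiableAt_theta4 (hq : ‖q‖ < 1) : DifferentiableAt ℂ theta4 q := by
  rw [show theta4 = fun q => theta3 (-q) from funext theta4_eq_theta3_neg]
  exact (differentiableAt_theta3 (by rwa [norm_neg])).comp q differentiableAt_id.neg

@[fun_prop]
lemma differentiableAt_psi (hq : ‖q‖ < 1) : DifferentiableAt ℂ psi q :=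
  differentiableAt_intPowSeries natAbs_le_toNat_sq_add_self hq

@[fun_prop]
lemma differentiableAt_theta2_pow_four (hq : ‖q‖ < 1) :
    DifferentiableAt ℂ (fun p => theta2 p ^ 4) q := by
  simp only [theta2_pow_four]
  fun_prop (disch := assumption)

end differentiable

/-! ### Quadratic transformations -/

lemma norm_sq_lt_one {q : ℂ} (hq : ‖q‖ < 1) : ‖q ^ 2‖ < 1 := by
  rw [norm_pow]; exact pow_lt_one₀ (norm_nonneg _) hq two_ne_zero

/-- The splitting of `ℤ²` into the pairs `(a + b, a - b)`, with even coordinate sum, and the pairs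
`(a + b + 1, a - b)`, with odd coordinate sum. It changes the quadratic form of a product of two
theta series at `q` into that of a product at `q²`. -/
def paritySplit : (ℤ × ℤ) ⊕ (ℤ × ℤ) ≃ ℤ × ℤ :=
  Equiv.ofBijective
    (Sum.elim (fun v => (v.1 + v.2, v.1 - v.2)) (fun v => (v.1 + v.2 + 1, v.1 - v.2))) <| by
    constructor
    · rintro (⟨a, b⟩ | ⟨a, b⟩) (⟨c, d⟩ | ⟨c, d⟩) h <;>
        simp only [Sum.elim_inl, Sum.elim_inr, Prod.mk.injEq, Sum.inl.injEq, Sum.inr.injEq,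
          reduceCtorEq] at h ⊢ <;> omega
    · rintro ⟨m, n⟩
      rcases Int.even_or_odd' (m + n) with ⟨k, h | h⟩
      · exact ⟨Sum.inl (k, m - k), by simp only [Sum.elim_inl, Prod.mk.injEq]; omega⟩
      · exact ⟨Sum.inr (k, m - k - 1), by simp only [Sum.elim_inr, Prod.mk.injEq]; omega⟩

lemma tsum_parity_split {f : ℤ × ℤ → ℂ} (hf : Summable f) :
    ∑' v, f v = ∑' v : ℤ × ℤ, f (v.1 + v.2, v.1 - v.2) +
      ∑' v : ℤ × ℤ, f (v.1 + v.2 + 1, v.1 - v.2) := by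
  have hs : Summable (f ∘ paritySplit) := paritySplit.summable_iff.2 hf
  rw [← paritySplit.tsum_eq]
  exact (HasSum.sum (f := f ∘ paritySplit)
    (hs.comp_injective Sum.inl_injective).hasSum
    (hs.comp_injective Sum.inr_injective).hasSum).tsum_eq

section quadratic

variable {q : ℂ}

lemma theta3_sq (hq : ‖q‖ < 1) : theta3 q ^ 2 = theta3 (q ^ 2) ^ 2 + q * psi (q ^ 2) ^ 2 := by
  have hq2 := norm_sq_lt_one hq
  simp only [theta3_eq_intPowSeries, psi, sq (intPowSeries _ _)]
  rw [intPowSeries_mul natAbs_le_natAbs_sq natAbs_le_natAbs_sq hq hq,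
    intPowSeries_mul natAbs_le_natAbs_sq natAbs_le_natAbs_sq hq2 hq2,
    intPowSeries_mul natAbs_le_toNat_sq_add_self natAbs_le_toNat_sq_add_self hq2 hq2,
    tsum_parity_split (summable_intPow_mul natAbs_le_natAbs_sq natAbs_le_natAbs_sq hq hq),
    ← tsum_mul_left]
  congr 1
  · refine tsum_congr fun v => ?_
    simp only [← pow_mul, ← pow_add]
    congr 1; zify; simp only [sq_abs]; ring
  · refine tsum_congr fun v => ?_
    simp only [← pow_mul, ← pow_add, ← pow_succ']
    congr 1; zify; simp only [sq_abs, toNat_sq_add_self]; ring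

lemma theta4_sq (hq : ‖q‖ < 1) : theta4 q ^ 2 = theta3 (q ^ 2) ^ 2 - q * psi (q ^ 2) ^ 2 := by
  rw [theta4_eq_theta3_neg, theta3_sq (by rwa [norm_neg]), neg_sq]; ring

lemma psi_sq (hq : ‖q‖ < 1) : psi q ^ 2 = 2 * (psi (q ^ 2) * theta3 (q ^ 2)) := by
  have hq2 := norm_sq_lt_one hq
  rw [theta3_eq_intPowSeries]
  simp only [psi, sq (intPowSeries _ _)]
  rw [intPowSeries_mul natAbs_le_toNat_sq_add_self natAbs_le_toNat_sq_add_self hq hq,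
    intPowSeries_mul natAbs_le_toNat_sq_add_self natAbs_le_natAbs_sq hq2 hq2, two_mul,
    tsum_parity_split
      (summable_intPow_mul natAbs_le_toNat_sq_add_self natAbs_le_toNat_sq_add_self hq hq)]
  congr 1
  · refine tsum_congr fun v => ?_
    simp only [← pow_mul, ← pow_add]
    congr 1; zify; simp only [sq_abs, toNat_sq_add_self]; ring
  · conv_rhs => rw [← ((Equiv.prodComm ℤ ℤ).trans
      ((Equiv.refl ℤ).prodCongr (Equiv.addRight (1 : ℤ)))).tsum_eq]
    refine tsum_congr fun v => ?_
    simp only [← pow_mul, ← pow_add, Equiv.trans_apply, Equiv.prodComm_apply, Prod.swap,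
      Equiv.prodCongr_apply, Prod.map, Equiv.coe_addRight, Equiv.refl_apply]
    congr 1; zify; simp only [sq_abs, toNat_sq_add_self]; ring

lemma theta3_pow_four (hq : ‖q‖ < 1) : theta3 q ^ 4 = theta2 q ^ 4 + theta4 q ^ 4 := by
  rw [theta2_pow_four]
  linear_combination (theta3 q ^ 2 + theta3 (q ^ 2) ^ 2 + q * psi (q ^ 2) ^ 2) * theta3_sq hq -
    (theta4 q ^ 2 + theta3 (q ^ 2) ^ 2 - q * psi (q ^ 2) ^ 2) * theta4_sq hq -
    q * (psi q ^ 2 + 2 * (psi (q ^ 2) * theta3 (q ^ 2))) * psi_sq hq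

lemma theta2_pow_four_add_theta3_pow_four_comp_sq (hq : ‖q‖ < 1) :
    2 * (theta2 (q ^ 2) ^ 4 + theta3 (q ^ 2) ^ 4) = 2 * theta3 q ^ 4 - theta2 q ^ 4 := by
  rw [theta2_pow_four (q ^ 2)]
  linear_combination -theta3_pow_four hq -
    (theta3 q ^ 2 + theta3 (q ^ 2) ^ 2 + q * psi (q ^ 2) ^ 2) * theta3_sq hq -
    (theta4 q ^ 2 + theta3 (q ^ 2) ^ 2 - q * psi (q ^ 2) ^ 2) * theta4_sq hq

lemma theta2_pow_four_mul_theta3_pow_four_comp_sq (hq : ‖q‖ < 1) :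
    16 * (theta2 (q ^ 2) ^ 4 * theta3 (q ^ 2) ^ 4) = (theta2 q ^ 4) ^ 2 := by
  rw [theta2_pow_four, theta2_pow_four, show (q * psi q ^ 4) ^ 2 = q ^ 2 * (psi q ^ 2) ^ 4 by ring,
    psi_sq hq]
  ring

lemma theta4_pow_four_comp_sq (hq : ‖q‖ < 1) :
    theta4 (q ^ 2) ^ 4 = theta3 q ^ 2 * theta4 q ^ 2 := by
  rw [theta3_sq hq, theta4_sq hq]
  linear_combination -theta2_pow_four (q ^ 2) - theta3_pow_four (norm_sq_lt_one hq)

end quadratic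

/-! ### Iterating `q ↦ q²` -/

lemma norm_pow_two_pow_lt_one {q : ℂ} (hq : ‖q‖ < 1) (n : ℕ) : ‖q ^ 2 ^ n‖ < 1 := by
  rw [norm_pow]; exact pow_lt_one₀ (norm_nonneg _) hq (by positivity)

lemma tendsto_pow_two_pow {q : ℂ} (hq : ‖q‖ < 1) :
    Tendsto (fun n : ℕ => q ^ 2 ^ n) atTop (𝓝 0) :=
  (tendsto_pow_atTop_nhds_zero_of_norm_lt_one hq).comp
    (tendsto_pow_atTop_atTop_of_one_lt one_lt_two)

lemma apply_zero_mem_of_comp_sq {X : Type*} [TopologicalSpace X] {f : ℂ → X} {s : Set X}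
    (hc : ContinuousAt f 0) (hs : IsClosed s) (hf : ∀ p, ‖p‖ < 1 → f p ∈ s → f (p ^ 2) ∈ s)
    {q : ℂ} (hq : ‖q‖ < 1) (hqs : f q ∈ s) : f 0 ∈ s := by
  have hmem (n : ℕ) : f (q ^ 2 ^ n) ∈ s := by
    induction n with
    | zero => simpa using hqs
    | succ n ih =>
      rw [pow_succ, pow_mul]
      exact hf _ (norm_pow_two_pow_lt_one hq n) ih
  exact hs.mem_of_tendsto (hc.tendsto.comp (tendsto_pow_two_pow hq)) (.of_forall hmem)

lemma eq_apply_zero_of_eq_comp_sq {X : Type*} [TopologicalSpace X] [T1Space X] {f : ℂ → X}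
    (hc : ContinuousAt f 0) (hf : ∀ p, ‖p‖ < 1 → f p = f (p ^ 2)) {q : ℂ} (hq : ‖q‖ < 1) :
    f q = f 0 :=
  (apply_zero_mem_of_comp_sq (s := {f q}) hc isClosed_singleton
    (fun p hp h => (hf p hp).symm.trans h) hq rfl).symm

lemma tendsto_pow_mul_pow_two_pow (c : ℂ) {q : ℂ} (hq : ‖q‖ < 1) :
    Tendsto (fun n : ℕ => c ^ n * q ^ 2 ^ n) atTop (𝓝 0) := by
  obtain ⟨k, hk⟩ := pow_unbounded_of_one_lt ‖c‖ one_lt_two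
  have h := (tendsto_pow_const_mul_const_pow_of_abs_lt_one k
    (r := ‖q‖) (by rwa [abs_norm])).comp (tendsto_pow_atTop_atTop_of_one_lt one_lt_two)
  refine squeeze_zero_norm (fun n => ?_) h
  calc ‖c ^ n * q ^ 2 ^ n‖ = ‖c‖ ^ n * ‖q‖ ^ 2 ^ n := by rw [norm_mul, norm_pow, norm_pow]
    _ ≤ (2 ^ k) ^ n * ‖q‖ ^ 2 ^ n := by gcongr
    _ = ((2 ^ n : ℕ) : ℝ) ^ k * ‖q‖ ^ 2 ^ n := by push_cast; rw [pow_right_comm]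

lemma eq_zero_of_eq_mul_comp_sq {f : ℂ → ℂ} {c : ℂ} (hd : DifferentiableAt ℂ f 0) (h0 : f 0 = 0)
    (hf : ∀ p, ‖p‖ < 1 → f p = c * f (p ^ 2)) {q : ℂ} (hq : ‖q‖ < 1) : f q = 0 := by
  have hiter (n : ℕ) : f q = c ^ n * f (q ^ 2 ^ n) := by
    induction n with
    | zero => simp
    | succ n ih =>
      rw [ih, hf _ (norm_pow_two_pow_lt_one hq n), pow_succ 2 n, pow_mul]; ring
  have hO : f =O[𝓝 0] fun w => w := by simpa [h0] using hd.isBigO_sub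
  have hlim := ((Asymptotics.isBigO_refl (fun n : ℕ => c ^ n) atTop).mul
    (hO.comp_tendsto (tendsto_pow_two_pow hq))).trans_tendsto (tendsto_pow_mul_pow_two_pow c hq)
  exact tendsto_nhds_unique tendsto_const_nhds (hlim.congr fun n => (hiter n).symm)

lemma theta4_ne_zero {q : ℂ} (hq : ‖q‖ < 1) : theta4 q ≠ 0 := by
  intro h
  have hc : ContinuousAt theta4 0 := (differentiableAt_theta4 (by simp)).continuousAt
  have h0 : theta4 0 = 0 := apply_zero_mem_of_comp_sq (s := {0}) hc isClosed_singleton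
    (fun p hp (h : theta4 p = 0) => show theta4 (p ^ 2) = 0 by
      rw [← pow_eq_zero_iff four_ne_zero, theta4_pow_four_comp_sq hp, h]; ring) hq h
  exact one_ne_zero (theta4_zero.symm.trans h0)

lemma theta3_ne_zero {q : ℂ} (hq : ‖q‖ < 1) : theta3 q ≠ 0 := by
  simpa [theta4_eq_theta3_neg] using theta4_ne_zero (q := -q) (by rwa [norm_neg])

lemma psi_ne_zero {q : ℂ} (hq : ‖q‖ < 1) : psi q ≠ 0 := by
  intro h
  have hc : ContinuousAt psi 0 := (differentiableAt_psi (by simp)).continuousAt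
  have h0 : psi 0 = 0 := apply_zero_mem_of_comp_sq (s := {0}) hc isClosed_singleton
    (fun p hp (h : psi p = 0) => show psi (p ^ 2) = 0 by
      have hp2 := psi_sq hp
      rw [h] at hp2
      simpa [theta3_ne_zero (norm_sq_lt_one hp)] using hp2.symm) hq h
  exact two_ne_zero (psi_zero.symm.trans h0)

/-! ### The operator `D` and logarithmic derivatives -/

/-- The logarithmic derivative `D f / f` with respect to `D = q d/dq`. -/
def dlog (f : ℂ → ℂ) (q : ℂ) : ℂ := q * logDeriv f q

section rules

variable {f g : ℂ → ℂ} {q : ℂ}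

lemma eventually_norm_lt_one (hq : ‖q‖ < 1) : ∀ᶠ p in 𝓝 q, ‖p‖ < 1 :=
  continuous_norm.continuousAt.eventually_lt continuousAt_const hq

lemma D_congr (h : ∀ p, ‖p‖ < 1 → f p = g p) (hq : ‖q‖ < 1) : D f q = D g q := by
  rw [D, D, EventuallyEq.deriv_eq ((eventually_norm_lt_one hq).mono h)]

lemma D_zero (f : ℂ → ℂ) : D f 0 = 0 := zero_mul _

lemma D_add (hf : DifferentiableAt ℂ f q) (hg : DifferentiableAt ℂ g q) :
    D (fun p => f p + g p) q = D f q + D g q := by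
  simp only [D, deriv_fun_add hf hg]; ring

lemma D_mul (hf : DifferentiableAt ℂ f q) (hg : DifferentiableAt ℂ g q) :
    D (fun p => f p * g p) q = D f q * g q + f q * D g q := by
  simp only [D, deriv_fun_mul hf hg]; ring

lemma D_const_mul (c : ℂ) : D (fun p => c * f p) q = c * D f q := by
  simp only [D, deriv_const_mul_field]; ring

lemma D_pow (hf : DifferentiableAt ℂ f q) (n : ℕ) :
    D (fun p => f p ^ n) q = n * f q ^ (n - 1) * D f q := by
  simp only [D, deriv_fun_pow hf]; ring

lemma D_id : D (fun p => p) q = q := by simp [D]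

lemma D_comp_sq (hf : DifferentiableAt ℂ f (q ^ 2)) :
    D (fun p => f (p ^ 2)) q = 2 * D f (q ^ 2) := by
  have h : HasDerivAt (fun p => f (p ^ 2)) (deriv f (q ^ 2) * (2 * q)) q :=
    (hf.hasDerivAt.comp q (hasDerivAt_pow 2 q)).congr_deriv (by simp)
  simp only [D, h.deriv]; ring

lemma differentiableAt_comp_sq (hf : DifferentiableAt ℂ f (q ^ 2)) :
    DifferentiableAt ℂ (fun p => f (p ^ 2)) q :=
  hf.comp q (differentiableAt_pow 2)

lemma differentiableAt_deriv (hf : ∀ p, ‖p‖ < 1 → DifferentiableAt ℂ f p) (hq : ‖q‖ < 1) :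
    DifferentiableAt ℂ (deriv f) q := by
  have hf' : DifferentiableOn ℂ f (Metric.ball 0 1) := fun p hp =>
    (hf p (mem_ball_zero_iff.1 hp)).differentiableWithinAt
  exact (hf'.deriv Metric.isOpen_ball).differentiableAt
    (Metric.isOpen_ball.mem_nhds (mem_ball_zero_iff.2 hq))

lemma differentiableAt_D (hf : ∀ p, ‖p‖ < 1 → DifferentiableAt ℂ f p) (hq : ‖q‖ < 1) :
    DifferentiableAt ℂ (D f) q :=
  differentiableAt_id.mul (differentiableAt_deriv hf hq)

lemma D_eq_dlog_mul (h : f q ≠ 0) : D f q = dlog f q * f q := by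
  rw [dlog, logDeriv_apply, D]; field_simp

lemma dlog_zero (f : ℂ → ℂ) : dlog f 0 = 0 := zero_mul _

lemma dlog_congr (h : ∀ p, ‖p‖ < 1 → f p = g p) (hq : ‖q‖ < 1) : dlog f q = dlog g q := by
  have hfg := (eventually_norm_lt_one hq).mono h
  rw [dlog, dlog, logDeriv_apply, logDeriv_apply, EventuallyEq.deriv_eq hfg, hfg.self_of_nhds]

lemma dlog_mul (hf : DifferentiableAt ℂ f q) (hg : DifferentiableAt ℂ g q) (hf0 : f q ≠ 0)
    (hg0 : g q ≠ 0) : dlog (fun p => f p * g p) q = dlog f q + dlog g q := by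
  rw [dlog, logDeriv_mul q hf0 hg0 hf hg, mul_add, dlog, dlog]

lemma dlog_const_mul {c : ℂ} (hc : c ≠ 0) : dlog (fun p => c * f p) q = dlog f q := by
  rw [dlog, logDeriv_const_mul q c hc, dlog]

lemma dlog_pow (hf : DifferentiableAt ℂ f q) (n : ℕ) :
    dlog (fun p => f p ^ n) q = n * dlog f q := by
  rw [dlog, logDeriv_fun_pow hf, dlog]; ring

lemma dlog_comp_sq (hf : DifferentiableAt ℂ f (q ^ 2)) :
    dlog (fun p => f (p ^ 2)) q = 2 * dlog f (q ^ 2) := by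
  have h := D_comp_sq hf
  simp only [D] at h
  simp only [dlog, logDeriv_apply]
  linear_combination h / f (q ^ 2)

lemma dlog_comp_neg : dlog (fun p => f (-p)) q = dlog f (-q) := by
  simp only [dlog, logDeriv_apply, deriv_comp_neg]; ring

lemma differentiableAt_dlog (hf : ∀ p, ‖p‖ < 1 → DifferentiableAt ℂ f p) (h0 : f q ≠ 0)
    (hq : ‖q‖ < 1) : DifferentiableAt ℂ (dlog f) q :=
  differentiableAt_id.mul ((differentiableAt_deriv hf hq).div (hf q hq) h0)

end rules

/-! ### Logarithmic derivatives of the theta series -/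

section theta

variable {q : ℂ}

@[fun_prop]
lemma differentiableAt_dlog_theta3 (hq : ‖q‖ < 1) : DifferentiableAt ℂ (dlog theta3) q :=
  differentiableAt_dlog (fun _ => differentiableAt_theta3) (theta3_ne_zero hq) hq

@[fun_prop]
lemma differentiableAt_dlog_theta4 (hq : ‖q‖ < 1) : DifferentiableAt ℂ (dlog theta4) q :=
  differentiableAt_dlog (fun _ => differentiableAt_theta4) (theta4_ne_zero hq) hq

@[fun_prop]
lemma differentiableAt_dlog_psi (hq : ‖q‖ < 1) : DifferentiableAt ℂ (dlog psi) q :=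
  differentiableAt_dlog (fun _ => differentiableAt_psi) (psi_ne_zero hq) hq

lemma theta3_sq_mul_dlog (hq : ‖q‖ < 1) :
    2 * theta3 q ^ 2 * dlog theta3 q = 4 * theta3 (q ^ 2) ^ 2 * dlog theta3 (q ^ 2) +
      q * psi (q ^ 2) ^ 2 * (1 + 4 * dlog psi (q ^ 2)) := by
  have hq2 := norm_sq_lt_one hq
  have d3 := differentiableAt_theta3 hq2
  have dpsi := differentiableAt_psi hq2
  have c3 := differentiableAt_comp_sq d3
  have cpsi := differentiableAt_comp_sq dpsi
  have h := D_congr (fun p hp => theta3_sq hp) hq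
  rw [D_pow (differentiableAt_theta3 hq),
    D_add (c3.fun_pow 2) (differentiableAt_fun_id.fun_mul (cpsi.fun_pow 2)), D_pow c3,
    D_comp_sq d3, D_mul differentiableAt_fun_id (cpsi.fun_pow 2), D_id, D_pow cpsi,
    D_comp_sq dpsi, D_eq_dlog_mul (theta3_ne_zero hq), D_eq_dlog_mul (theta3_ne_zero hq2),
    D_eq_dlog_mul (psi_ne_zero hq2)] at h
  simp only [Nat.cast_ofNat, Nat.add_one_sub_one, pow_one] at h
  linear_combination h

lemma theta4_sq_mul_dlog (hq : ‖q‖ < 1) :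
    2 * theta4 q ^ 2 * dlog theta4 q = 4 * theta3 (q ^ 2) ^ 2 * dlog theta3 (q ^ 2) -
      q * psi (q ^ 2) ^ 2 * (1 + 4 * dlog psi (q ^ 2)) := by
  have h := theta3_sq_mul_dlog (q := -q) (by rwa [norm_neg])
  rw [neg_sq, ← dlog_comp_neg, ← theta4_eq_theta3_neg] at h
  rw [show theta4 = fun p => theta3 (-p) from funext theta4_eq_theta3_neg] at h ⊢
  linear_combination h

lemma dlog_psi_eq (hq : ‖q‖ < 1) : dlog psi q = dlog psi (q ^ 2) + dlog theta3 (q ^ 2) := by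
  have hq2 := norm_sq_lt_one hq
  have d3 := differentiableAt_theta3 hq2
  have dpsi := differentiableAt_psi hq2
  have h := dlog_congr (fun p hp => psi_sq hp) hq
  rw [dlog_pow (differentiableAt_psi hq), dlog_const_mul two_ne_zero,
    dlog_mul (differentiableAt_comp_sq dpsi) (differentiableAt_comp_sq d3) (psi_ne_zero hq2)
      (theta3_ne_zero hq2), dlog_comp_sq dpsi, dlog_comp_sq d3] at h
  push_cast at h
  linear_combination h / 2

lemma dlog_theta4_comp_sq (hq : ‖q‖ < 1) :
    4 * dlog theta4 (q ^ 2) = dlog theta3 q + dlog theta4 q := by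
  have d3 := differentiableAt_theta3 hq
  have d4 := differentiableAt_theta4 hq
  have d4' := differentiableAt_theta4 (norm_sq_lt_one hq)
  have h := dlog_congr (fun p hp => theta4_pow_four_comp_sq hp) hq
  rw [dlog_pow (differentiableAt_comp_sq d4'), dlog_comp_sq d4',
    dlog_mul (d3.fun_pow 2) (d4.fun_pow 2) (pow_ne_zero 2 (theta3_ne_zero hq))
      (pow_ne_zero 2 (theta4_ne_zero hq)), dlog_pow d3, dlog_pow d4] at h
  push_cast at h
  linear_combination h / 2

/-- Since `4 dlog θ₂ = 1 + 4 dlog ψ`, this is `dlog (θ₂⁴ / θ₃⁴) = θ₄⁴`: the quotient of the two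
sides is invariant under `q ↦ q²`. -/
lemma dlog_psi_sub_dlog_theta3 (hq : ‖q‖ < 1) :
    1 + 4 * dlog psi q - 4 * dlog theta3 q = theta4 q ^ 4 := by
  have hconst := eq_apply_zero_of_eq_comp_sq
    (f := fun p => (1 + 4 * dlog psi p - 4 * dlog theta3 p) / theta4 p ^ 4) ?_ ?_ hq
  · simp only [dlog_zero, theta4_zero] at hconst
    rw [div_eq_iff (pow_ne_zero 4 (theta4_ne_zero hq))] at hconst
    linear_combination hconst
  · have h0 : ‖(0 : ℂ)‖ < 1 := by simp
    have h4 : theta4 0 ^ 4 ≠ 0 := pow_ne_zero 4 (theta4_ne_zero h0)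
    exact DifferentiableAt.continuousAt (by fun_prop (disch := assumption))
  · intro p hp
    have h3 := theta3_ne_zero hp
    have h4 := theta4_ne_zero hp
    have hstep : (1 + 4 * dlog psi p - 4 * dlog theta3 p) * theta3 p ^ 2 =
        (1 + 4 * dlog psi (p ^ 2) - 4 * dlog theta3 (p ^ 2)) * theta4 p ^ 2 := by
      rw [dlog_psi_eq hp]
      linear_combination -2 * theta3_sq_mul_dlog hp +
        (1 + 4 * dlog psi (p ^ 2) + 4 * dlog theta3 (p ^ 2)) * theta3_sq hp -
        (1 + 4 * dlog psi (p ^ 2) - 4 * dlog theta3 (p ^ 2)) * theta4_sq hp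
    rw [theta4_pow_four_comp_sq hp, div_eq_div_iff (by positivity) (by positivity)]
    linear_combination theta4 p ^ 2 * hstep

lemma dlog_theta3_sub_dlog_theta4 (hq : ‖q‖ < 1) :
    4 * dlog theta3 q - 4 * dlog theta4 q = theta2 q ^ 4 := by
  have h3 := pow_ne_zero 2 (theta3_ne_zero hq)
  have h4 := pow_ne_zero 2 (theta4_ne_zero hq)
  have hpsi : theta2 q ^ 4 = 4 * q * psi (q ^ 2) ^ 2 * theta3 (q ^ 2) ^ 2 := by
    rw [theta2_pow_four, show psi q ^ 4 = (psi q ^ 2) ^ 2 by ring, psi_sq hq]; ring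
  have hdlog : 1 + 4 * dlog psi (q ^ 2) - 4 * dlog theta3 (q ^ 2) = theta3 q ^ 2 * theta4 q ^ 2 :=
    (dlog_psi_sub_dlog_theta3 (norm_sq_lt_one hq)).trans (theta4_pow_four_comp_sq hq)
  refine mul_left_cancel₀ (mul_ne_zero h3 h4) ?_
  calc theta3 q ^ 2 * theta4 q ^ 2 * (4 * dlog theta3 q - 4 * dlog theta4 q)
    _ = 2 * theta4 q ^ 2 * (2 * theta3 q ^ 2 * dlog theta3 q) -
        2 * theta3 q ^ 2 * (2 * theta4 q ^ 2 * dlog theta4 q) := by ring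
    _ = 4 * q * psi (q ^ 2) ^ 2 * theta3 (q ^ 2) ^ 2 *
        (1 + 4 * dlog psi (q ^ 2) - 4 * dlog theta3 (q ^ 2)) := by
      rw [theta3_sq_mul_dlog hq, theta4_sq_mul_dlog hq, theta3_sq hq, theta4_sq hq]; ring
    _ = theta3 q ^ 2 * theta4 q ^ 2 * theta2 q ^ 4 := by rw [hdlog, hpsi]; ring

end theta

/-! ### The Jacobi triple product -/

/-- The `q`-Pochhammer symbol `∏_{j=1}^{n} (1 - p ^ j)`. -/
def qPoch (p : ℂ) (n : ℕ) : ℂ := ∏ j ∈ Finset.range n, (1 - p ^ (j + 1))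

/-- The Euler product `∏_{j ≥ 1} (1 - p ^ j)`, the limit of the `q`-Pochhammer symbols. -/
def eulerPhi (p : ℂ) : ℂ := ∏' j : ℕ, (1 - p ^ (j + 1))

/-- The reciprocal of the `q`-Pochhammer symbol, extended by zero to negative `n`. With this
convention `invPoch_sub_one` holds for every integer. -/
def invPoch (p : ℂ) (n : ℤ) : ℂ := if 0 ≤ n then (qPoch p n.toNat)⁻¹ else 0

section qPoch

variable {p : ℂ}

lemma one_sub_pow_succ_ne_zero (hp : ‖p‖ < 1) (j : ℕ) : 1 - p ^ (j + 1) ≠ 0 := by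
  intro h
  have h1 : ‖p ^ (j + 1)‖ < 1 := by
    rw [norm_pow]; exact pow_lt_one₀ (norm_nonneg _) hp j.succ_ne_zero
  rw [← sub_eq_zero.1 h, norm_one] at h1
  exact lt_irrefl _ h1

lemma qPoch_ne_zero (hp : ‖p‖ < 1) (n : ℕ) : qPoch p n ≠ 0 :=
  Finset.prod_ne_zero_iff.2 fun j _ => one_sub_pow_succ_ne_zero hp j

lemma qPoch_succ (p : ℂ) (n : ℕ) : qPoch p (n + 1) = qPoch p n * (1 - p ^ (n + 1)) :=
  Finset.prod_range_succ _ _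

lemma eulerPhi_ne_zero (hp : ‖p‖ < 1) : eulerPhi p ≠ 0 := by
  have h := tprod_one_add_ne_zero_of_summable (f := fun j : ℕ => -p ^ (j + 1))
    (fun j => by simpa [← sub_eq_add_neg] using one_sub_pow_succ_ne_zero hp j)
    (by simpa using (summable_nat_add_iff 1).2 (summable_geometric_of_lt_one (norm_nonneg _) hp))
  simpa [eulerPhi, sub_eq_add_neg] using h

lemma tendsto_qPoch (hp : ‖p‖ < 1) : Tendsto (qPoch p) atTop (𝓝 (eulerPhi p)) :=
  (ModularForm.multipliable_one_sub_pow hp).tendsto_prod_tprod_nat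

lemma invPoch_sub_one (hp : ‖p‖ < 1) (n : ℤ) :
    invPoch p (n - 1) = (1 - p ^ n) * invPoch p n := by
  rcases lt_trichotomy n 0 with h | rfl | h
  · rw [invPoch, invPoch, if_neg (by omega), if_neg (by omega), mul_zero]
  · simp [invPoch]
  · obtain ⟨m, rfl⟩ : ∃ m : ℕ, n = (m + 1 : ℕ) := ⟨(n - 1).toNat, by omega⟩
    have hm := qPoch_ne_zero hp m
    have hj := one_sub_pow_succ_ne_zero hp m
    rw [invPoch, invPoch, if_pos (by omega), if_pos (by omega), Nat.cast_add_one,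
      add_sub_cancel_right, Int.toNat_natCast, ← Nat.cast_add_one, Int.toNat_natCast, qPoch_succ,
      zpow_natCast]
    field_simp

lemma tendsto_invPoch (hp : ‖p‖ < 1) : Tendsto (invPoch p) atTop (𝓝 (eulerPhi p)⁻¹) := by
  have h : Tendsto (fun n : ℤ => (qPoch p n.toNat)⁻¹) atTop (𝓝 (eulerPhi p)⁻¹) :=
    ((tendsto_qPoch hp).inv₀ (eulerPhi_ne_zero hp)).comp
      (tendsto_atTop_atTop.2 fun b => ⟨b, fun a ha => by omega⟩)
  refine h.congr' ?_
  filter_upwards [eventually_ge_atTop 0] with n hn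
  rw [invPoch, if_pos hn]

lemma exists_norm_invPoch_le (hp : ‖p‖ < 1) : ∃ C, ∀ n, ‖invPoch p n‖ ≤ C := by
  obtain ⟨C, hC⟩ := (Metric.isBounded_range_of_tendsto _
    ((tendsto_qPoch hp).inv₀ (eulerPhi_ne_zero hp))).exists_norm_le
  refine ⟨C, fun n => ?_⟩
  rw [invPoch]
  split_ifs
  · exact hC _ ⟨_, rfl⟩
  · rw [norm_zero]; exact (norm_nonneg _).trans (hC _ ⟨0, rfl⟩)

end qPoch

/-- The coefficient of `z ^ k` in `∏_{j=1}^{N} (1 + z q^{2j-1}) (1 + z⁻¹ q^{2j-1})`, divided by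
`∏_{j=1}^{2N} (1 - q^{2j})`. -/
def tripleCoeff (q : ℂ) (N : ℕ) (k : ℤ) : ℂ :=
  q ^ (k ^ 2) * (invPoch (q ^ 2) (N - k) * invPoch (q ^ 2) (N + k))

section tripleProduct

variable {q z : ℂ}

lemma invPoch_sq_sub_one (hq : ‖q‖ < 1) (n : ℤ) :
    invPoch (q ^ 2) (n - 1) = (1 - q ^ (2 * n)) * invPoch (q ^ 2) n := by
  rw [invPoch_sub_one (norm_sq_lt_one hq), zpow_mul]; norm_cast

lemma tripleCoeff_succ (h0 : q ≠ 0) (hq : ‖q‖ < 1) (N : ℕ) (k : ℤ) :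
    (1 - q ^ (4 * N + 2)) * (1 - q ^ (4 * N + 4)) * tripleCoeff q (N + 1) k =
      (1 + q ^ (4 * N + 2)) * tripleCoeff q N k +
        q ^ (2 * N + 1) * (tripleCoeff q N (k - 1) + tripleCoeff q N (k + 1)) := by
  set r := invPoch (q ^ 2) with hr
  set u : ℂ := q ^ (2 * ((N : ℤ) - k)) with hu
  set v : ℂ := q ^ (2 * ((N : ℤ) + k)) with hv
  have hshift (n : ℤ) : r n = (1 - q ^ 2 * q ^ (2 * n)) * r (n + 1) := by
    have h := invPoch_sq_sub_one hq (n + 1)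
    rw [add_sub_cancel_right, mul_add_one, zpow_add₀ h0, zpow_ofNat] at h
    rw [hr, h, mul_comm (q ^ 2)]
  have r1 : r (N - k) = (1 - q ^ 2 * u) * r (N + 1 - k) := by
    rw [hshift, sub_add_eq_add_sub]
  have r2 : r (N + k) = (1 - q ^ 2 * v) * r (N + 1 + k) := by
    rw [hshift, add_right_comm]
  have r3 : r (N - (k + 1)) = (1 - u) * r (N - k) := by
    rw [← sub_sub, hr, hu, invPoch_sq_sub_one hq]
  have r4 : r (N + (k - 1)) = (1 - v) * r (N + k) := by
    rw [← add_sub_assoc, hr, hv, invPoch_sq_sub_one hq]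
  have uv : u * v = q ^ (4 * N) := by
    rw [hu, hv, ← zpow_add₀ h0, ← zpow_natCast]; congr 1; push_cast; ring
  have e1 : q ^ (2 * N + 1) * q ^ ((k - 1) ^ 2) = q ^ (k ^ 2) * (q ^ 2 * u) := by
    rw [hu, ← zpow_natCast, ← zpow_natCast, ← zpow_add₀ h0, ← zpow_add₀ h0, ← zpow_add₀ h0]
    congr 1; push_cast; ring
  have e2 : q ^ (2 * N + 1) * q ^ ((k + 1) ^ 2) = q ^ (k ^ 2) * (q ^ 2 * v) := by
    rw [hv, ← zpow_natCast, ← zpow_natCast, ← zpow_add₀ h0, ← zpow_add₀ h0, ← zpow_add₀ h0]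
    congr 1; push_cast; ring
  simp only [tripleCoeff, ← hr, Nat.cast_add_one]
  rw [mul_add, ← mul_assoc (q ^ (2 * N + 1)), ← mul_assoc (q ^ (2 * N + 1)), e1, e2, r3, r4,
    show (N - (k - 1) : ℤ) = N + 1 - k by ring, show (N + (k + 1) : ℤ) = N + 1 + k by ring,
    r1, r2, pow_add q (4 * N) 2, pow_add q (4 * N) 4, ← uv]
  ring

lemma tripleCoeff_eq_zero (q : ℂ) {N : ℕ} {k : ℤ} (h : k ∉ Finset.Icc (-(N : ℤ)) N) :
    tripleCoeff q N k = 0 := by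
  rw [Finset.mem_Icc, not_and_or] at h
  rw [tripleCoeff, invPoch, invPoch]
  rcases h with h | h
  · rw [if_neg (show ¬ (0 ≤ (N : ℤ) + k) by omega)]; simp only [mul_zero]
  · rw [if_neg (show ¬ (0 ≤ (N : ℤ) - k) by omega)]; simp only [zero_mul, mul_zero]

lemma summable_zpow_mul_tripleCoeff (z q : ℂ) (N : ℕ) :
    Summable fun k : ℤ => z ^ k * tripleCoeff q N k :=
  summable_of_ne_finset_zero (s := Finset.Icc (-(N : ℤ)) N) fun k hk => by
    rw [tripleCoeff_eq_zero q hk, mul_zero]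

lemma tsum_zpow_mul_tripleCoeff_succ (hz : z ≠ 0) (h0 : q ≠ 0) (hq : ‖q‖ < 1) (N : ℕ) :
    (1 - q ^ (4 * N + 2)) * (1 - q ^ (4 * N + 4)) * ∑' k : ℤ, z ^ k * tripleCoeff q (N + 1) k =
      (1 + z * q ^ (2 * N + 1)) * (1 + z⁻¹ * q ^ (2 * N + 1)) *
        ∑' k : ℤ, z ^ k * tripleCoeff q N k := by
  have hs := (summable_zpow_mul_tripleCoeff z q N).hasSum
  have hsub : HasSum (fun k : ℤ => z ^ k * tripleCoeff q N (k - 1))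
      (z * ∑' k : ℤ, z ^ k * tripleCoeff q N k) := by
    rw [← (Equiv.addRight (1 : ℤ)).hasSum_iff]
    refine (hs.mul_left z).congr_fun fun k => ?_
    simp only [Function.comp_apply, Equiv.coe_addRight, add_sub_cancel_right, zpow_add_one₀ hz]
    ring
  have hadd : HasSum (fun k : ℤ => z ^ k * tripleCoeff q N (k + 1))
      (z⁻¹ * ∑' k : ℤ, z ^ k * tripleCoeff q N k) := by
    rw [← (Equiv.subRight (1 : ℤ)).hasSum_iff]
    refine (hs.mul_left z⁻¹).congr_fun fun k => ?_
    simp only [Function.comp_apply, Equiv.subRight_apply, sub_add_cancel, zpow_sub_one₀ hz]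
    ring
  have hrec := (hs.mul_left (1 + q ^ (4 * N + 2))).add
    ((hsub.add hadd).mul_left (q ^ (2 * N + 1)))
  rw [← tsum_mul_left, tsum_congr fun k => ?_, hrec.tsum_eq]
  · field_simp; ring
  · linear_combination z ^ k * tripleCoeff_succ h0 hq N k

lemma qPoch_mul_tsum_tripleCoeff (hz : z ≠ 0) (h0 : q ≠ 0) (hq : ‖q‖ < 1) (N : ℕ) :
    qPoch (q ^ 2) (2 * N) * ∑' k : ℤ, z ^ k * tripleCoeff q N k =
      ∏ j ∈ Finset.range N, (1 + z * q ^ (2 * j + 1)) * (1 + z⁻¹ * q ^ (2 * j + 1)) := by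
  induction N with
  | zero =>
    rw [tsum_eq_single 0 fun k hk => by rw [tripleCoeff_eq_zero, mul_zero]; simpa using hk]
    simp [tripleCoeff, invPoch, qPoch]
  | succ N ih =>
    rw [Finset.prod_range_succ, ← ih, mul_add_one, qPoch_succ, qPoch_succ, ← pow_mul, ← pow_mul,
      show 2 * (2 * N + 1) = 4 * N + 2 by ring, show 2 * (2 * N + 1 + 1) = 4 * N + 4 by ring]
    linear_combination qPoch (q ^ 2) (2 * N) * tsum_zpow_mul_tripleCoeff_succ hz h0 hq N

lemma summable_norm_zpow_mul_pow_natAbs_sq (hz : z ≠ 0) (h0 : q ≠ 0) (hq : ‖q‖ < 1) :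
    Summable fun k : ℤ => ‖z ^ k * q ^ (k.natAbs ^ 2)‖ := by
  have hnat {w : ℂ} (hw : w ≠ 0) : Summable fun n : ℕ => ‖w ^ n * q ^ (n ^ 2)‖ := by
    refine summable_of_ratio_test_tendsto_lt_one zero_lt_one
      (.of_forall fun n => norm_ne_zero_iff.2 (by positivity)) ?_
    have hlim : Tendsto (fun n : ℕ => ‖w‖ * ‖q‖ ^ (2 * n + 1)) atTop (𝓝 (‖w‖ * 0)) :=
      ((tendsto_pow_atTop_nhds_zero_of_lt_one (norm_nonneg q) hq).comp
        (tendsto_atTop_mono (fun n => by simp only [id]; omega) tendsto_id)).const_mul _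
    rw [mul_zero] at hlim
    refine hlim.congr fun n => ?_
    rw [norm_norm, norm_norm, ← norm_div, ← norm_pow, ← norm_mul]
    congr 1
    field_simp
    ring
  refine Summable.of_nat_of_neg ?_ ?_
  · simpa using hnat hz
  · simpa using hnat (inv_ne_zero hz)

lemma tendsto_qPoch_mul_tsum_tripleCoeff (hz : z ≠ 0) (h0 : q ≠ 0) (hq : ‖q‖ < 1) :
    Tendsto (fun N : ℕ => qPoch (q ^ 2) (2 * N) * ∑' k : ℤ, z ^ k * tripleCoeff q N k) atTop
      (𝓝 ((∑' k : ℤ, z ^ k * q ^ (k ^ 2)) * (eulerPhi (q ^ 2))⁻¹)) := by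
  have hp := norm_sq_lt_one hq
  have hphi := eulerPhi_ne_zero hp
  obtain ⟨C, hC⟩ := exists_norm_invPoch_le hp
  have hC0 : 0 ≤ C := (norm_nonneg _).trans (hC 0)
  have hterm (k : ℤ) : Tendsto (fun N : ℕ => z ^ k * tripleCoeff q N k) atTop
      (𝓝 (z ^ k * (q ^ (k ^ 2) * ((eulerPhi (q ^ 2))⁻¹ * (eulerPhi (q ^ 2))⁻¹)))) :=
    tendsto_const_nhds.mul (tendsto_const_nhds.mul
      (((tendsto_invPoch hp).comp
        (tendsto_atTop_add_const_right _ (-k) tendsto_natCast_atTop_atTop)).mul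
      ((tendsto_invPoch hp).comp
        (tendsto_atTop_add_const_right _ k tendsto_natCast_atTop_atTop))))
  have hbound (N : ℕ) (k : ℤ) :
      ‖z ^ k * tripleCoeff q N k‖ ≤ ‖z ^ k * q ^ (k.natAbs ^ 2)‖ * (C * C) := by
    rw [tripleCoeff, ← mul_assoc, norm_mul, norm_mul (invPoch _ _), zpow_sq_eq_pow_natAbs_sq]
    gcongr <;> exact hC _
  have hsum := tendsto_tsum_of_dominated_convergence
    ((summable_norm_zpow_mul_pow_natAbs_sq hz h0 hq).mul_right _) hterm
    (.of_forall fun N k => hbound N k)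
  have hpoch : Tendsto (fun N : ℕ => qPoch (q ^ 2) (2 * N)) atTop (𝓝 (eulerPhi (q ^ 2))) :=
    (tendsto_qPoch hp).comp (tendsto_id.const_mul_atTop' two_pos)
  convert hpoch.mul hsum using 2
  simp only [← mul_assoc, tsum_mul_right]
  field_simp

lemma multipliable_one_add_mul_odd_pow (z : ℂ) (hq : ‖q‖ < 1) :
    Multipliable fun j : ℕ => 1 + z * q ^ (2 * j + 1) := by
  have h : Summable fun j : ℕ => ‖q‖ ^ (2 * j + 1) :=
    (summable_geometric_of_lt_one (norm_nonneg _) hq).comp_injective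
      (i := fun j : ℕ => 2 * j + 1) fun a b h => by simpa using h
  exact multipliable_one_add_of_summable (by simpa using h.mul_left ‖z‖)

lemma jacobi_triple_product (hz : z ≠ 0) (h0 : q ≠ 0) (hq : ‖q‖ < 1) :
    ∑' k : ℤ, z ^ k * q ^ (k ^ 2) = eulerPhi (q ^ 2) *
      ((∏' j : ℕ, (1 + z * q ^ (2 * j + 1))) * ∏' j : ℕ, (1 + z⁻¹ * q ^ (2 * j + 1))) := by
  have hphi := eulerPhi_ne_zero (norm_sq_lt_one hq)
  have hlim := ((multipliable_one_add_mul_odd_pow z hq).tendsto_prod_tprod_nat).mul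
    (multipliable_one_add_mul_odd_pow z⁻¹ hq).tendsto_prod_tprod_nat
  simp only [← Finset.prod_mul_distrib, ← qPoch_mul_tsum_tripleCoeff hz h0 hq] at hlim
  rw [tendsto_nhds_unique hlim (tendsto_qPoch_mul_tsum_tripleCoeff hz h0 hq)]
  field_simp

lemma eulerPhi_eq_tprod_odd_mul (hq : ‖q‖ < 1) :
    eulerPhi q = (∏' j : ℕ, (1 - q ^ (2 * j + 1))) * eulerPhi (q ^ 2) := by
  have heven (j : ℕ) : 1 - (q ^ 2) ^ (j + 1) = 1 - q ^ (2 * j + 1 + 1) := by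
    rw [← pow_mul, mul_add_one]
  have hodd : Multipliable fun j : ℕ => 1 - q ^ (2 * j + 1) := by
    simpa [← sub_eq_add_neg] using multipliable_one_add_mul_odd_pow (-1) hq
  rw [eulerPhi, ← tprod_even_mul_odd (f := fun j => 1 - q ^ (j + 1)) hodd
    ((ModularForm.multipliable_one_sub_pow (norm_sq_lt_one hq)).congr heven), eulerPhi,
    tprod_congr heven]

lemma theta4_mul_eulerPhi_sq (hq : ‖q‖ < 1) : theta4 q * eulerPhi (q ^ 2) = eulerPhi q ^ 2 := by
  rcases eq_or_ne q 0 with rfl | h0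
  · simp [theta4_zero, eulerPhi]
  have htriple := jacobi_triple_product (neg_ne_zero.2 one_ne_zero) h0 hq
  simp only [inv_neg, inv_one, neg_one_mul, ← sub_eq_add_neg] at htriple
  rw [theta4, htriple, eulerPhi_eq_tprod_odd_mul hq]
  ring

end tripleProduct

/-! ### The Eisenstein series `E₂` -/

section eisenstein

variable {q : ℂ}

lemma differentiableAt_eulerPhi (hq : ‖q‖ < 1) : DifferentiableAt ℂ eulerPhi q :=
  ModularForm.differentiableOn_tprod_one_sub_pow.differentiableAt
    (Metric.isOpen_ball.mem_nhds (mem_ball_zero_iff.2 hq))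

lemma eisenstein_one (q : ℂ) : eisenstein 1 q =
    1 - 24 * ∑' n : ℕ+, (ArithmeticFunction.sigma 1 (n : ℕ) : ℂ) * q ^ (n : ℕ) := by
  simp only [eisenstein, mul_one, bernoulli_two]
  norm_num

lemma eisenstein_one_zero : eisenstein 1 0 = 1 := by simp [eisenstein_one]

lemma dlog_one_sub_pow_succ (hq : ‖q‖ < 1) (n : ℕ) :
    dlog (fun p => 1 - p ^ (n + 1)) q =
      -(((n + 1 : ℕ) : ℂ) ^ 1 * q ^ (n + 1) / (1 - q ^ (n + 1))) := by
  have hn := one_sub_pow_succ_ne_zero hq n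
  rw [dlog, logDeriv_apply, deriv_const_sub, deriv_pow_field, add_tsub_cancel_right]
  field_simp
  ring

lemma dlog_eulerPhi (hq : ‖q‖ < 1) : 24 * dlog eulerPhi q = eisenstein 1 q - 1 := by
  rcases eq_or_ne q 0 with rfl | h0
  · rw [dlog_zero, eisenstein_one_zero]; ring
  have hsum : Summable fun n : ℕ => logDeriv (fun p : ℂ => 1 - p ^ (n + 1)) q := by
    rw [← summable_mul_left_iff h0]
    have h := summable_norm_pow_mul_geometric_div_one_sub 1 hq
    exact ((summable_nat_add_iff 1).2 h).neg.congr fun n =>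
      (dlog_one_sub_pow_succ hq n).symm
  have htprod : logDeriv eulerPhi q = ∑' n : ℕ, logDeriv (fun p : ℂ => 1 - p ^ (n + 1)) q :=
    logDeriv_tprod_eq_tsum Metric.isOpen_ball (mem_ball_zero_iff.2 hq)
      (one_sub_pow_succ_ne_zero hq) (fun n => by fun_prop) hsum
      ModularForm.multipliableLocallyUniformlyOn_one_sub_pow (eulerPhi_ne_zero hq)
  have hdlog : dlog eulerPhi q =
      -∑' n : ℕ+, (ArithmeticFunction.sigma 1 (n : ℕ) : ℂ) * q ^ (n : ℕ) := by
    rw [dlog, htprod, ← tsum_mul_left, ← tsum_pow_div_one_sub_eq_tsum_sigma hq 1,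
      tsum_pnat_eq_tsum_succ (f := fun n : ℕ => (n : ℂ) ^ 1 * q ^ n / (1 - q ^ n)), ← tsum_neg]
    exact tsum_congr (dlog_one_sub_pow_succ hq)
  rw [hdlog, eisenstein_one]
  ring

@[fun_prop]
lemma differentiableAt_eisenstein_one (hq : ‖q‖ < 1) : DifferentiableAt ℂ (eisenstein 1) q := by
  have h : DifferentiableAt ℂ (fun p => 24 * dlog eulerPhi p + 1) q :=
    ((differentiableAt_dlog (fun _ => differentiableAt_eulerPhi) (eulerPhi_ne_zero hq)
      hq).const_mul 24).add_const 1
  refine h.congr_of_eventuallyEq ((eventually_norm_lt_one hq).mono fun p hp => ?_)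
  linear_combination -dlog_eulerPhi hp

lemma dlog_theta4_eq_eisenstein_sub (hq : ‖q‖ < 1) :
    24 * dlog theta4 q = 2 * eisenstein 1 q - 2 * eisenstein 1 (q ^ 2) := by
  have hq2 := norm_sq_lt_one hq
  have dphi := differentiableAt_eulerPhi hq2
  have h := dlog_congr (fun p hp => theta4_mul_eulerPhi_sq hp) hq
  rw [dlog_mul (differentiableAt_theta4 hq) (differentiableAt_comp_sq dphi) (theta4_ne_zero hq)
    (eulerPhi_ne_zero hq2), dlog_comp_sq dphi, dlog_pow (differentiableAt_eulerPhi hq)] at h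
  push_cast at h
  linear_combination 24 * h + 2 * dlog_eulerPhi hq - 2 * dlog_eulerPhi hq2

lemma dlog_theta4 (hq : ‖q‖ < 1) :
    24 * dlog theta4 q = eisenstein 1 q - theta2 q ^ 4 - theta3 q ^ 4 := by
  have h := eq_apply_zero_of_eq_comp_sq
    (f := fun p => 24 * dlog theta4 p + theta2 p ^ 4 + theta3 p ^ 4 - eisenstein 1 p) ?_ ?_ hq
  · simp only [dlog_zero, theta2_zero_pow_four, theta3_zero, eisenstein_one_zero] at h
    linear_combination h
  · have h0 : ‖(0 : ℂ)‖ < 1 := by simp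
    exact DifferentiableAt.continuousAt (by fun_prop (disch := assumption))
  · intro p hp
    linear_combination -3 / 2 * dlog_theta3_sub_dlog_theta4 hp - 6 * dlog_theta4_comp_sq hp -
      theta2_pow_four_add_theta3_pow_four_comp_sq hp / 2 + dlog_theta4_eq_eisenstein_sub hp / 2

lemma eisenstein_one_comp_sq (hq : ‖q‖ < 1) :
    2 * eisenstein 1 (q ^ 2) = eisenstein 1 q + theta2 q ^ 4 + theta3 q ^ 4 := by
  linear_combination dlog_theta4_eq_eisenstein_sub hq - dlog_theta4 hq

end eisenstein

/-! ### The differential system -/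

section system

variable {q : ℂ}

lemma D_theta4 (hq : ‖q‖ < 1) :
    24 * D theta4 q = theta4 q * (eisenstein 1 q - theta2 q ^ 4 - theta3 q ^ 4) := by
  rw [D_eq_dlog_mul (theta4_ne_zero hq), ← dlog_theta4 hq]
  ring

lemma D_theta3_pow_four (hq : ‖q‖ < 1) :
    6 * D (fun p => theta3 p ^ 4) q =
      theta3 q ^ 4 * (eisenstein 1 q + 5 * theta2 q ^ 4 - theta3 q ^ 4) := by
  rw [D_pow (differentiableAt_theta3 hq), D_eq_dlog_mul (theta3_ne_zero hq)]
  push_cast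
  linear_combination theta3 q ^ 4 * (6 * dlog_theta3_sub_dlog_theta4 hq + dlog_theta4 hq)

lemma D_theta2_pow_four (hq : ‖q‖ < 1) :
    6 * D (fun p => theta2 p ^ 4) q =
      theta2 q ^ 4 * (eisenstein 1 q + 5 * theta3 q ^ 4 - theta2 q ^ 4) := by
  have dpsi := differentiableAt_psi hq
  have hD : D (fun p => theta2 p ^ 4) q = theta2 q ^ 4 * (1 + 4 * dlog psi q) := by
    simp only [theta2_pow_four]
    rw [D_mul differentiableAt_fun_id (dpsi.fun_pow 4), D_id, D_pow dpsi,
      D_eq_dlog_mul (psi_ne_zero hq)]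
    push_cast
    ring
  linear_combination 6 * hD + theta2 q ^ 4 * (6 * dlog_psi_sub_dlog_theta3 hq +
    6 * dlog_theta3_sub_dlog_theta4 hq + dlog_theta4 hq - 6 * theta3_pow_four hq)

lemma D_eisenstein_one_comp_sq (hq : ‖q‖ < 1) :
    4 * D (eisenstein 1) (q ^ 2) =
      D (eisenstein 1) q + D (fun p => theta2 p ^ 4) q + D (fun p => theta3 p ^ 4) q := by
  have dE := differentiableAt_eisenstein_one (norm_sq_lt_one hq)
  have d3 : DifferentiableAt ℂ (fun p => theta3 p ^ 4) q := by fun_prop (disch := assumption)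
  have h := D_congr (fun p hp => eisenstein_one_comp_sq hp) hq
  rw [D_const_mul, D_comp_sq dE, D_add (by fun_prop (disch := assumption)) d3,
    D_add (by fun_prop (disch := assumption)) (by fun_prop (disch := assumption))] at h
  linear_combination h

/-- The difference `F` of the two sides satisfies `F(q) = 4 F(q²)`. -/
lemma D_eisenstein_one (hq : ‖q‖ < 1) :
    12 * D (eisenstein 1) q = eisenstein 1 q ^ 2 - (theta2 q ^ 4) ^ 2 -
      14 * theta2 q ^ 4 * theta3 q ^ 4 - (theta3 q ^ 4) ^ 2 := by
  have h := eq_zero_of_eq_mul_comp_sq (c := 4) (f := fun p => 12 * D (eisenstein 1) p -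
    (eisenstein 1 p ^ 2 - (theta2 p ^ 4) ^ 2 - 14 * theta2 p ^ 4 * theta3 p ^ 4 -
      (theta3 p ^ 4) ^ 2)) ?_ ?_ ?_ hq
  · linear_combination h
  · have h0 : ‖(0 : ℂ)‖ < 1 := by simp
    have hD := differentiableAt_D (fun _ => differentiableAt_eisenstein_one) h0
    fun_prop (disch := assumption)
  · simp only [D_zero, eisenstein_one_zero, theta2_zero_pow_four, theta3_zero]; ring
  · intro p hp
    linear_combination -12 * D_eisenstein_one_comp_sq hp - 2 * D_theta2_pow_four hp -
      2 * D_theta3_pow_four hp +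
      (2 * eisenstein 1 (p ^ 2) + eisenstein 1 p + theta2 p ^ 4 + theta3 p ^ 4) *
        eisenstein_one_comp_sq hp -
      (2 * (theta2 (p ^ 2) ^ 4 + theta3 (p ^ 2) ^ 4) + 2 * theta3 p ^ 4 - theta2 p ^ 4) *
        theta2_pow_four_add_theta3_pow_four_comp_sq hp -
      3 * theta2_pow_four_mul_theta3_pow_four_comp_sq hp

end system

/-! ### The coefficients `cc` -/

lemma cc_eq_zero {α β γ : ℤ} (h : α < 0 ∨ β < 0 ∨ γ < 0) : cc α β γ = 0 := by
  rw [cc, if_pos h]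

lemma cc_zero : cc 0 0 0 = 1 := by
  rw [cc, if_neg (by simp), if_pos (by simp)]

lemma cc_rec {α β γ : ℤ} (h : ¬(α = 0 ∧ β = 0 ∧ γ = 0)) :
    cc α β γ = (2 * α + 4 * β + 4 * γ - 1) / 24 * cc (α - 1) β γ
    + (20 * γ - 4 * β + 3) / 24 * cc α (β - 1) γ
    + (20 * β - 4 * γ + 3) / 24 * cc α β (γ - 1)
    - 7 * (α + 1) / 6 * cc (α + 1) (β - 1) (γ - 1)
    - (α + 1) / 12 * cc (α + 1) (β - 2) γ
    - (α + 1) / 12 * cc (α + 1) β (γ - 2) := by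
  by_cases hneg : α < 0 ∨ β < 0 ∨ γ < 0
  · rw [cc_eq_zero hneg, cc_eq_zero (α := α - 1) (by omega), cc_eq_zero (β := β - 1) (by omega),
      cc_eq_zero (γ := γ - 1) (by omega)]
    rcases eq_or_ne α (-1) with rfl | hα
    · norm_num
    · rw [cc_eq_zero (α := α + 1) (β := β - 1) (by omega), cc_eq_zero (β := β - 2) (by omega),
        cc_eq_zero (γ := γ - 2) (by omega)]
      ring
  · rw [cc, if_neg hneg, if_neg h]

lemma cc_symm (α β γ : ℤ) : cc α β γ = cc α γ β := by
  induction hn : (α + β + γ).toNat using Nat.strong_induction_on generalizing α β γ with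
  | _ n ih =>
    by_cases hneg : α < 0 ∨ β < 0 ∨ γ < 0
    · rw [cc_eq_zero hneg, cc_eq_zero (by omega)]
    by_cases h0 : α = 0 ∧ β = 0 ∧ γ = 0
    · rw [h0.2.1, h0.2.2]
    have ih' {a b c : ℤ} (h : a + b + c = α + β + γ - 1) : cc a b c = cc a c b :=
      ih _ (by omega) a b c rfl
    rw [cc_rec h0, cc_rec (α := α) (β := γ) (by tauto), ih' (a := α - 1) (by ring),
      ih' (b := β - 1) (c := γ) (by ring), ih' (c := γ - 1) (by ring),
      ih' (b := β - 1) (c := γ - 1) (by ring), ih' (b := β - 2) (by ring),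
      ih' (c := γ - 2) (by ring)]
    ring

/-- The transpose of the recursion for `cc`: the linear operator on arrays for which
`∑ cc v * f v`, summed over `|v| = t + 1`, equals `∑ cc v * ccTranspose f v` over `|v| = t`. -/
def ccTranspose (f : ℤ → ℤ → ℤ → ℂ) (α β γ : ℤ) : ℂ :=
  (2 * α + 4 * β + 4 * γ + 1) / 24 * f (α + 1) β γ
  + (20 * γ - 4 * β - 1) / 24 * f α (β + 1) γ
  + (20 * β - 4 * γ - 1) / 24 * f α β (γ + 1)
  - 7 * α / 6 * f (α - 1) (β + 1) (γ + 1)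
  - α / 12 * f (α - 1) (β + 2) γ
  - α / 12 * f (α - 1) β (γ + 2)

section transpose

open Finset.Nat (antidiagonalTuple mem_antidiagonalTuple)

/-- The plane `α + β + γ = t` in `ℤ³` is parametrized by `(β, γ)`. -/
lemma hasSum_cc_mul (t : ℕ) (f : ℤ → ℤ → ℤ → ℂ) :
    HasSum (fun p : ℤ × ℤ => (cc (t - p.1 - p.2) p.1 p.2 : ℂ) * f (t - p.1 - p.2) p.1 p.2)
      (∑ v ∈ antidiagonalTuple 3 t, (cc (v 0) (v 1) (v 2) : ℂ) * f (v 0) (v 1) (v 2)) := by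
  let e (v : Fin 3 → ℕ) : ℤ × ℤ := (v 1, v 2)
  have hsum {v : Fin 3 → ℕ} (hv : v ∈ antidiagonalTuple 3 t) : (v 0 : ℤ) = t - v 1 - v 2 := by
    rw [mem_antidiagonalTuple, Fin.sum_univ_three] at hv
    omega
  have hinj : Set.InjOn e (antidiagonalTuple 3 t) := by
    intro v hv w hw h
    have h0 := hsum hv
    have h0' := hsum hw
    simp only [e, Prod.mk.injEq, Nat.cast_inj] at h
    ext i
    fin_cases i <;> simp <;> omega
  have hsupp (p : ℤ × ℤ) (hp : p ∉ (antidiagonalTuple 3 t).image e) :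
      (cc (t - p.1 - p.2) p.1 p.2 : ℂ) * f (t - p.1 - p.2) p.1 p.2 = 0 := by
    rw [cc_eq_zero, Rat.cast_zero, zero_mul]
    by_contra! h
    refine hp (Finset.mem_image.2 ⟨![(t - p.1 - p.2).toNat, p.1.toNat, p.2.toNat], ?_, ?_⟩)
    · rw [mem_antidiagonalTuple, Fin.sum_univ_three]
      simp only [Matrix.cons_val]
      omega
    · simp [e, h]
  have h := hasSum_sum_of_ne_finset_zero (L := .unconditional _) hsupp
  rw [Finset.sum_image hinj] at h
  convert h using 1
  exact Finset.sum_congr rfl fun v hv => by rw [hsum hv]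

lemma hasSum_cc_sub_mul (t : ℕ) (f : ℤ → ℤ → ℤ → ℂ) {i j k : ℤ} (h : i + j + k = 1) :
    HasSum (fun p : ℤ × ℤ => (cc (t + 1 - p.1 - p.2 - i) (p.1 - j) (p.2 - k) : ℂ) *
        f (t + 1 - p.1 - p.2) p.1 p.2)
      (∑ v ∈ antidiagonalTuple 3 t,
        (cc (v 0) (v 1) (v 2) : ℂ) * f (v 0 + i) (v 1 + j) (v 2 + k)) := by
  rw [← (Equiv.addRight ((j, k) : ℤ × ℤ)).hasSum_iff]
  refine (hasSum_cc_mul t fun α β γ => f (α + i) (β + j) (γ + k)).congr_fun fun p => ?_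
  obtain rfl : i = 1 - j - k := by omega
  simp only [Function.comp_apply, Equiv.coe_addRight, Prod.fst_add, Prod.snd_add]
  congr 2 <;> ring_nf

lemma sum_cc_mul_succ (t : ℕ) (f : ℤ → ℤ → ℤ → ℂ) :
    ∑ v ∈ antidiagonalTuple 3 (t + 1), (cc (v 0) (v 1) (v 2) : ℂ) * f (v 0) (v 1) (v 2) =
      ∑ v ∈ antidiagonalTuple 3 t,
        (cc (v 0) (v 1) (v 2) : ℂ) * ccTranspose f (v 0) (v 1) (v 2) := by
  have h1 := hasSum_cc_sub_mul t (i := 1) (j := 0) (k := 0)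
    (fun α β γ => (2 * α + 4 * β + 4 * γ - 1) / 24 * f α β γ) (by norm_num)
  have h2 := hasSum_cc_sub_mul t (i := 0) (j := 1) (k := 0)
    (fun α β γ => (20 * γ - 4 * β + 3) / 24 * f α β γ) (by norm_num)
  have h3 := hasSum_cc_sub_mul t (i := 0) (j := 0) (k := 1)
    (fun α β γ => (20 * β - 4 * γ + 3) / 24 * f α β γ) (by norm_num)
  have h4 := hasSum_cc_sub_mul t (i := -1) (j := 1) (k := 1)
    (fun α β γ => 7 * (α + 1) / 6 * f α β γ) (by norm_num)
  have h5 := hasSum_cc_sub_mul t (i := -1) (j := 2) (k := 0)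
    (fun α β γ => (α + 1) / 12 * f α β γ) (by norm_num)
  have h6 := hasSum_cc_sub_mul t (i := -1) (j := 0) (k := 2)
    (fun α β γ => (α + 1) / 12 * f α β γ) (by norm_num)
  have h := ((((h1.add h2).add h3).sub h4).sub h5).sub h6
  simp only [← Finset.sum_add_distrib, ← Finset.sum_sub_distrib] at h
  refine ((hasSum_cc_mul (t + 1) f).unique (h.congr_fun fun p => ?_)).trans
    (Finset.sum_congr rfl fun v _ => ?_)
  · rw [Nat.cast_add_one, cc_rec (by omega)]
    simp only [sub_zero, sub_neg_eq_add]
    push_cast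
    ring
  · simp only [ccTranspose, add_zero, ← sub_eq_add_neg]
    push_cast
    ring

lemma sum_antidiagonalTuple_three_swap {M : Type*} [AddCommMonoid M] (t : ℕ)
    (f : ℕ → ℕ → ℕ → M) :
    ∑ v ∈ antidiagonalTuple 3 t, f (v 0) (v 1) (v 2) =
      ∑ v ∈ antidiagonalTuple 3 t, f (v 0) (v 2) (v 1) := by
  have hmem (v : Fin 3 → ℕ) (hv : v ∈ antidiagonalTuple 3 t) :
      ![v 0, v 2, v 1] ∈ antidiagonalTuple 3 t := by
    rw [mem_antidiagonalTuple, Fin.sum_univ_three] at *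
    simp only [Matrix.cons_val]
    omega
  have hinv (v : Fin 3 → ℕ) : ![v 0, v 1, v 2] = v := by ext i; fin_cases i <;> rfl
  exact Finset.sum_nbij' (fun v => ![v 0, v 2, v 1]) (fun v => ![v 0, v 2, v 1]) hmem hmem
    (fun v _ => hinv v) (fun v _ => hinv v) fun _ _ => rfl

lemma sum_cc_mul_swap (t : ℕ) (f : ℕ → ℕ → ℕ → ℂ) :
    ∑ v ∈ antidiagonalTuple 3 t, (cc (v 0) (v 1) (v 2) : ℂ) * f (v 0) (v 2) (v 1) =
      ∑ v ∈ antidiagonalTuple 3 t, (cc (v 0) (v 1) (v 2) : ℂ) * f (v 0) (v 1) (v 2) := by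
  rw [sum_antidiagonalTuple_three_swap t fun α β γ => (cc α β γ : ℂ) * f α β γ]
  exact Finset.sum_congr rfl fun v _ => by rw [cc_symm]

end transpose

/-! ### Iterated derivatives of `θ₄` -/

/-- The monomial `E₂^α θ₂^{4β} θ₃^{4γ}`. The exponents are integers, like the arguments of `cc`;
negative ones are truncated to `0`. -/
def thetaMonomial (α β γ : ℤ) (q : ℂ) : ℂ :=
  eisenstein 1 q ^ α.toNat * (theta2 q ^ 4) ^ β.toNat * (theta3 q ^ 4) ^ γ.toNat

section iterate

variable {q : ℂ}

open Finset.Nat (antidiagonalTuple)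

@[fun_prop]
lemma differentiableAt_thetaMonomial (α β γ : ℤ) (hq : ‖q‖ < 1) :
    DifferentiableAt ℂ (thetaMonomial α β γ) q := by
  unfold thetaMonomial
  fun_prop (disch := assumption)

lemma D_sum {ι : Type*} {f : ι → ℂ → ℂ} (s : Finset ι)
    (hf : ∀ i ∈ s, DifferentiableAt ℂ (f i) q) :
    D (fun p => ∑ i ∈ s, f i p) q = ∑ i ∈ s, D (f i) q := by
  simp only [D, deriv_fun_sum hf, Finset.mul_sum]

lemma natCast_mul_pow_sub_one_mul {R : Type*} [Semiring R] (n : ℕ) (x : R) :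
    n * x ^ (n - 1) * x = n * x ^ n := by
  rcases n with _ | n
  · simp
  · rw [Nat.add_one_sub_one, mul_assoc, pow_succ]

lemma D_pow_of_D_eq_mul {f : ℂ → ℂ} {c : ℂ} (hf : DifferentiableAt ℂ f q)
    (h : D f q = f q * c) (n : ℕ) : D (fun p => f p ^ n) q = f q ^ n * (n * c) := by
  rw [D_pow hf, h]
  linear_combination c * natCast_mul_pow_sub_one_mul n (f q)

lemma D_thetaMonomial (α β γ : ℕ) (hq : ‖q‖ < 1) :
    D (thetaMonomial α β γ) q = thetaMonomial α β γ q *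
        (β * ((eisenstein 1 q + 5 * theta3 q ^ 4 - theta2 q ^ 4) / 6) +
          γ * ((eisenstein 1 q + 5 * theta2 q ^ 4 - theta3 q ^ 4) / 6)) +
      α * thetaMonomial (α - 1) β γ q * ((eisenstein 1 q ^ 2 - (theta2 q ^ 4) ^ 2 -
        14 * theta2 q ^ 4 * theta3 q ^ 4 - (theta3 q ^ 4) ^ 2) / 12) := by
  have dE := differentiableAt_eisenstein_one hq
  have d2 := differentiableAt_theta2_pow_four hq
  have d3 : DifferentiableAt ℂ (fun p => theta3 p ^ 4) q := by fun_prop (disch := assumption)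
  have h2 := D_pow_of_D_eq_mul (c := (eisenstein 1 q + 5 * theta3 q ^ 4 - theta2 q ^ 4) / 6) d2
    (by linear_combination D_theta2_pow_four hq / 6) β
  have h3 := D_pow_of_D_eq_mul (c := (eisenstein 1 q + 5 * theta2 q ^ 4 - theta3 q ^ 4) / 6) d3
    (by linear_combination D_theta3_pow_four hq / 6) γ
  unfold thetaMonomial
  simp only [Int.toNat_natCast, Int.pred_toNat]
  rw [D_mul ((dE.fun_pow α).fun_mul (d2.fun_pow β)) (d3.fun_pow γ),
    D_mul (dE.fun_pow α) (d2.fun_pow β), D_pow dE, h2, h3]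
  linear_combination α * eisenstein 1 q ^ (α - 1) * (theta2 q ^ 4) ^ β * (theta3 q ^ 4) ^ γ *
    D_eisenstein_one hq / 12

lemma D_theta4_mul_thetaMonomial (α β γ : ℕ) (hq : ‖q‖ < 1) :
    D (fun p => theta4 p * thetaMonomial α β γ p) q =
      theta4 q * ccTranspose (fun a b c => thetaMonomial a b c q) α β γ := by
  have h1 (n : ℕ) : ((n : ℤ) + 1).toNat = n + 1 := by omega
  have h2 (n : ℕ) : ((n : ℤ) + 2).toNat = n + 2 := by omega
  have hα := natCast_mul_pow_sub_one_mul α (eisenstein 1 q)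
  rw [D_mul (differentiableAt_theta4 hq) (differentiableAt_thetaMonomial _ _ _ hq),
    D_thetaMonomial α β γ hq]
  simp only [ccTranspose, thetaMonomial, h1, h2, Int.pred_toNat, Int.toNat_natCast,
    Int.cast_natCast]
  linear_combination (theta2 q ^ 4) ^ β * (theta3 q ^ 4) ^ γ *
    (theta4 q * eisenstein 1 q / 12 * hα + eisenstein 1 q ^ α * D_theta4 hq / 24)

lemma iterate_D_theta4 (t : ℕ) (hq : ‖q‖ < 1) :
    D^[t] theta4 q = theta4 q * ∑ v ∈ antidiagonalTuple 3 t,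
      (cc (v 0) (v 1) (v 2) : ℂ) * thetaMonomial (v 0) (v 1) (v 2) q := by
  induction t generalizing q with
  | zero => simp [cc_zero, thetaMonomial, Finset.Nat.antidiagonalTuple_zero_right]
  | succ t ih =>
    calc D^[t + 1] theta4 q
      _ = D (fun p => ∑ v ∈ antidiagonalTuple 3 t, (cc (v 0) (v 1) (v 2) : ℂ) *
          (theta4 p * thetaMonomial (v 0) (v 1) (v 2) p)) q := by
        rw [Function.iterate_succ_apply']
        refine D_congr (fun p hp => ?_) hq
        rw [ih hp, Finset.mul_sum]
        exact Finset.sum_congr rfl fun v _ => mul_left_comm _ _ _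
      _ = ∑ v ∈ antidiagonalTuple 3 t, (cc (v 0) (v 1) (v 2) : ℂ) *
          (theta4 q * ccTranspose (fun a b c => thetaMonomial a b c q) (v 0) (v 1) (v 2)) := by
        rw [D_sum _ fun v _ => by fun_prop (disch := assumption)]
        exact Finset.sum_congr rfl fun v _ => by
          rw [D_const_mul, D_theta4_mul_thetaMonomial _ _ _ hq]
      _ = _ := by
        rw [sum_cc_mul_succ t fun a b c => thetaMonomial a b c q, Finset.mul_sum]
        exact Finset.sum_congr rfl fun v _ => mul_left_comm _ _ _

lemma sum_cc_mul_Theta (t : ℕ) (q : ℂ) :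
    ∑ v ∈ antidiagonalTuple 3 t,
        (cc (v 0) (v 1) (v 2) : ℂ) * eisenstein 1 q ^ v 0 * Theta (v 1) (v 2) q =
      2 * ∑ v ∈ antidiagonalTuple 3 t,
        (cc (v 0) (v 1) (v 2) : ℂ) * thetaMonomial (v 0) (v 1) (v 2) q := by
  have hTheta (α β γ : ℕ) : eisenstein 1 q ^ α * Theta β γ q =
      thetaMonomial α β γ q + thetaMonomial α γ β q := by
    simp only [Theta, thetaMonomial, Int.toNat_natCast, pow_mul]; ring
  simp only [mul_assoc, hTheta, mul_add, Finset.sum_add_distrib]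
  rw [sum_cc_mul_swap t fun α β γ => thetaMonomial α β γ q, two_mul]

end iterate

end QTheta

end

theorem theorem1p3 (t : ℕ) (ht : 1 ≤ t) (q : ℂ) (hq : ‖q‖ < 1) :
    QTheta.theta4 q ≠ 0 ∧
    (QTheta.D^[t] QTheta.theta4) q / QTheta.theta4 q =
      (1 / 2 : ℂ) * ∑ v ∈ Finset.Nat.antidiagonalTuple 3 t,
        ((QTheta.cc (v 0) (v 1) (v 2) : ℚ) : ℂ) *
          QTheta.eisenstein 1 q ^ (v 0) * QTheta.Theta (v 1) (v 2) q := by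
  have h4 := QTheta.theta4_ne_zero hq
  refine ⟨h4, ?_⟩
  rw [QTheta.iterate_D_theta4 t hq, mul_div_cancel_left₀ _ h4, QTheta.sum_cc_mul_Theta]
  ring
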